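/- Let $(\Omega,\mathcal F,\mathbb P)$ be a probability space, $\mathcal G\subseteq\mathcal F$ a sub-$\sigma$-algebra, and $L^\infty=L^\infty(\Omega,\mathcal F,\mathbb P)$, with $L^\infty(\mathcal G)\subseteq L^\infty$ the subspace of $\mathcal G$-measurable elements. A map $\rho:L^\infty\to\mathbb R$ is a *coherent risk measure* if it is cash invariant ($\rho(X+c)=\rho(X)+c$ for $c\in\mathbb R$), monotone ($X\le Y$ implies $\rho(X)\le\rho(Y)$), convex, and positively homogeneous ($\rho(\lambda X)=\lambda\rho(X)$ for $\lambda\ge 0$). A map $f:L^\infty\to\mathbb R$ is *Lebesgue continuous* (resp. *Fatou continuous*) if $f(X_n)\to f(X)$ (resp. $f(X)\le\liminf_n f(X_n)$) for every uniformly bounded sequence $(X_n)$ in $L^\infty$ that converges $\mathbb P$-a.s. to some $X\in L^\infty$. Let $\mathcal M(\mathcal G)$ (resp. $\mathcal M_1(\mathcal G)$) be the set of finite signed measures (resp. probability measures) on $(\Omega,\mathcal G)$ that are absolutely continuous with respect to $\mathbb P|_{\mathcal G}$. For $\mu\in\mathcal M(\mathcal G)$ let $D_\mu=\mathrm d\mu/\mathrm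 d\mathbb P|_{\mathcal G}$ and $\mathbb E^\mu[X]=\mathbb E[D_\mu X]$ for $X\in L^\infty$. Let $w=w(\mathcal M(\mathcal G),L^\infty(\mathcal G))$ be the coarsest topology on $\mathcal M(\mathcal G)$ for which $\mu\mapsto\mathbb E^\mu[Y]$ is continuous for every $Y\in L^\infty(\mathcal G)$. For $\mu\in\mathcal M_1(\mathcal G)$ let $\mathrm{CA}(\mu)$ be the set of all Fatou continuous maps $\tau:L^\infty\to\mathbb R$ that are convex, positively homogeneous, and satisfy $\tau(X+Y)=\tau(X)$ for all $X\in L^\infty$, $Y\in L^\infty(\mathcal G)$, and $\mathbb E^\mu[X]+\tau(X)\le\mathbb E^\mu[Y]+\tau(Y)$ for all $X,Y\in L^\infty$ with $X\le Y$. For $\mathcal R\subseteq\mathcal M_1(\mathcal G)$, a *CA-assignment* on $\mathcal R$ is a family $(\tau_\mu)_{\mu\in\mathcal R}$ with $\tau_\mu\in\mathrm{CA}(\mu)$ for all $\mu\in\mathcal R$; it is *Lebesgue continuous* if every $\tau_\mu$ is. For convex, $w$-closed $\mathcal R$ it is *regular* if for every $X\in L^\infty$ (a) $\lambda\tau_{\mu_1}(X)+(1-\lambda)\tau_{\mu_2}(X)\le\tau_{\lambda\mu_1+(1-\lambda)\mu_2}(X)$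 for all $\mu_1,\mu_2\in\mathcal R$ and $\lambda\in(0,1)$, and (b) $\tau_\mu(X)\ge\liminf_\alpha\tau_{\mu_\alpha}(X)$ for every net $(\mu_\alpha)$ in $\mathcal R$ that converges in $w$ to some $\mu\in\mathcal R$. **Proposition.** Let $\rho:L^\infty\to\mathbb R$ be a Lebesgue continuous coherent risk measure. Then there exists exactly one pair $(\mathcal R,(\tau_\mu)_{\mu\in\mathcal R})$ consisting of a $w$-compact convex set $\mathcal R\subseteq\mathcal M_1(\mathcal G)$ and a regular Lebesgue continuous CA-assignment $(\tau_\mu)_{\mu\in\mathcal R}$ such that $$\rho(X)=\sup_{\mu\in\mathcal R}\left(\mathbb E^\mu[X]+\tau_\mu(X)\right)\qquad\text{for all }X\in L^\infty.$$ -/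

import Mathlib

open MeasureTheory Filter Topology
open scoped ENNReal

universe u

namespace RiskMeasure

/-- The space `L^∞(Ω, ℱ, P)` of (classes of) essentially bounded random variables, with its
almost sure order. -/
abbrev LInf {Ω : Type u} [MeasurableSpace Ω] (P : Measure Ω) : Type u := Lp ℝ ∞ P

/-- The subspace `L^∞(𝒢)` of those elements of `L^∞` that are `𝒢`-measurable (that is, have a
`𝒢`-measurable version). -/
noncomputable abbrev LInfSub {Ω : Type u} (𝒢 : MeasurableSpace Ω) [ℱ : MeasurableSpace Ω]
    (P : Measure Ω) : Submodule ℝ (LInf P) := lpMeas ℝ ℝ 𝒢 ∞ P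

section Functionals

variable {Ω : Type u} [MeasurableSpace Ω] {P : Measure Ω}

/-- Convexity of a real functional on `L^∞`. -/
def IsConvexFunctional (f : LInf P → ℝ) : Prop :=
  ∀ (X Y : LInf P) (c : ℝ), 0 ≤ c → c ≤ 1 →
    f (c • X + (1 - c) • Y) ≤ c * f X + (1 - c) * f Y

/-- Positive homogeneity of a real functional on `L^∞`. -/
def IsPosHomogeneous (f : LInf P → ℝ) : Prop :=
  ∀ (X : LInf P) (c : ℝ), 0 ≤ c → f (c • X) = c * f X

/-- Coherent risk measures on `L^∞` (positive values of `X` are losses). -/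
structure IsCoherentRiskMeasure [IsFiniteMeasure P] (ρ : LInf P → ℝ) : Prop where
  cash_invariant : ∀ (X : LInf P) (c : ℝ), ρ (X + Lp.const ∞ P c) = ρ X + c
  monotone : ∀ X Y : LInf P, X ≤ Y → ρ X ≤ ρ Y
  convex : IsConvexFunctional ρ
  pos_homogeneous : IsPosHomogeneous ρ

/-- `X n → X` almost surely, the sequence being uniformly bounded in `L^∞`. -/
def BoundedAETendsto (Xs : ℕ → LInf P) (X : LInf P) : Prop :=
  (∃ C : ℝ, ∀ n, ‖Xs n‖ ≤ C) ∧ ∀ᵐ ω ∂P, Tendsto (fun n => Xs n ω) atTop (𝓝 (X ω))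

/-- Fatou continuity; the limit inferior is taken in the extended reals. -/
def IsFatouContinuous (f : LInf P → ℝ) : Prop :=
  ∀ (Xs : ℕ → LInf P) (X : LInf P), BoundedAETendsto Xs X →
    (f X : EReal) ≤ liminf (fun n => (f (Xs n) : EReal)) atTop

/-- Lebesgue continuity. -/
def IsLebesgueContinuous (f : LInf P → ℝ) : Prop :=
  ∀ (Xs : ℕ → LInf P) (X : LInf P), BoundedAETendsto Xs X →
    Tendsto (fun n => f (Xs n)) atTop (𝓝 (f X))

end Functionals

section SubSigmaAlgebra

variable {Ω : Type u} {𝒢 : MeasurableSpace Ω} [ℱ : MeasurableSpace Ω]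

/-- The vector space `ℳ(𝒢)` of finite signed measures on `(Ω, 𝒢)` that are absolutely continuous
with respect to the restriction of `P` to `𝒢`. -/
def acSignedMeasures (P : Measure Ω) (h𝒢 : 𝒢 ≤ ℱ) : Submodule ℝ (@SignedMeasure Ω 𝒢) where
  carrier := {μ | μ ≪ᵥ (P.trim h𝒢).toENNRealVectorMeasure}
  add_mem' := fun h₁ h₂ => h₁.add h₂
  zero_mem' := VectorMeasure.AbsolutelyContinuous.zero _
  smul_mem' := fun _ _ h => h.smul

/-- The set `ℳ₁(𝒢)` of probability measures in `ℳ(𝒢)`. -/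
def acProbabilities (P : Measure Ω) (h𝒢 : 𝒢 ≤ ℱ) : Set (acSignedMeasures P h𝒢) :=
  {μ | (∀ A, MeasurableSet[𝒢] A → 0 ≤ (μ : @SignedMeasure Ω 𝒢) A) ∧
    (μ : @SignedMeasure Ω 𝒢) Set.univ = 1}

/-- The Radon-Nikodym derivative `D_μ` of `μ` with respect to the restriction of `P` to `𝒢`. -/
noncomputable def density {P : Measure Ω} {h𝒢 : 𝒢 ≤ ℱ} (μ : acSignedMeasures P h𝒢) : Ω → ℝ :=
  @SignedMeasure.rnDeriv Ω 𝒢 (μ : @SignedMeasure Ω 𝒢) (P.trim h𝒢)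

/-- `𝔼^μ[X] = 𝔼[D_μ X]` for `μ ∈ ℳ(𝒢)` and an arbitrary `X ∈ L^∞`. -/
noncomputable def expect {P : Measure Ω} {h𝒢 : 𝒢 ≤ ℱ} (μ : acSignedMeasures P h𝒢)
    (X : LInf P) : ℝ :=
  ∫ ω, density μ ω * X ω ∂P

/-- The weak topology `w(ℳ(𝒢), L^∞(𝒢))`: the coarsest topology on `ℳ(𝒢)` that makes
`μ ↦ 𝔼^μ[Y]` continuous for every `Y ∈ L^∞(𝒢)`. -/
noncomputable abbrev weakTopology (P : Measure Ω) (h𝒢 : 𝒢 ≤ ℱ) : TopologicalSpace (acSignedMeasures P h𝒢) :=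
  TopologicalSpace.induced
    (fun (μ : acSignedMeasures P h𝒢) (Y : LInfSub 𝒢 P) => expect μ (Y : LInf P))
    Pi.topologicalSpace

/-- `μ`-coherent adjustments. -/
structure IsCoherentAdjustment {P : Measure Ω} {h𝒢 : 𝒢 ≤ ℱ} (μ : acSignedMeasures P h𝒢)
    (τ : LInf P → ℝ) : Prop where
  invariant : ∀ X Y : LInf P, Y ∈ LInfSub 𝒢 P → τ (X + Y) = τ X
  monotone : ∀ X Y : LInf P, X ≤ Y → expect μ X + τ X ≤ expect μ Y + τ Y
  convex : IsConvexFunctional τ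
  pos_homogeneous : IsPosHomogeneous τ

/-- The set `CA(μ)` of Fatou continuous `μ`-coherent adjustments. -/
def CA {P : Measure Ω} {h𝒢 : 𝒢 ≤ ℱ} (μ : acSignedMeasures P h𝒢) : Set (LInf P → ℝ) :=
  {τ | IsCoherentAdjustment μ τ ∧ IsFatouContinuous τ}

/-- A family `(τ_μ)_{μ ∈ ℛ}` with `τ_μ ∈ CA(μ)` for every `μ ∈ ℛ`. -/
def IsCAAssignment {P : Measure Ω} {h𝒢 : 𝒢 ≤ ℱ} (R : Set (acSignedMeasures P h𝒢))
    (τ : R → LInf P → ℝ) : Prop :=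
  ∀ μ : R, τ μ ∈ CA (μ : acSignedMeasures P h𝒢)

/-- Regularity of a family `(τ_μ)_{μ ∈ ℛ}` over a convex set `ℛ`: concavity in `μ`, and
semicontinuity in `μ` along nets in `ℛ` that converge weakly to an element of `ℛ`. -/
structure IsRegularAssignment {P : Measure Ω} {h𝒢 : 𝒢 ≤ ℱ} (R : Set (acSignedMeasures P h𝒢))
    (τ : R → LInf P → ℝ) : Prop where
  concave : ∀ (X : LInf P) (μ₁ μ₂ μ : R) (c : ℝ), 0 < c → c < 1 →
    (μ : acSignedMeasures P h𝒢) = c • (μ₁ : acSignedMeasures P h𝒢) + (1 - c) • μ₂ →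
    c * τ μ₁ X + (1 - c) * τ μ₂ X ≤ τ μ X
  semicontinuous : ∀ (Λ : Type u) [Preorder Λ] [IsDirectedOrder Λ] [Nonempty Λ]
    (m : Λ → R) (μ : R),
    Tendsto (fun i => (m i : acSignedMeasures P h𝒢)) atTop (@nhds _ (weakTopology P h𝒢) μ) →
    ∀ X : LInf P, liminf (fun i => (τ (m i) X : EReal)) atTop ≤ (τ μ X : EReal)

/-- The representation `ρ(X) = sup_{μ ∈ ℛ} (𝔼^μ[X] + τ_μ(X))` for all `X ∈ L^∞`. -/
def Represents {P : Measure Ω} {h𝒢 : 𝒢 ≤ ℱ} (R : Set (acSignedMeasures P h𝒢))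
    (τ : R → LInf P → ℝ) (ρ : LInf P → ℝ) : Prop :=
  ∀ X : LInf P,
    IsLUB (Set.range fun μ : R => expect (μ : acSignedMeasures P h𝒢) X + τ μ X) (ρ X)

end SubSigmaAlgebra

end RiskMeasure

open RiskMeasure

namespace RiskMeasure

/-! ### Densities and the pairing of measures on `𝒢` with `L^∞`. -/

section Expectation

set_option linter.unusedSectionVars false

variable {Ω : Type u} {𝒢 : MeasurableSpace Ω} [ℱ : MeasurableSpace Ω] {h𝒢 : 𝒢 ≤ ℱ}
  {P : Measure Ω} [IsProbabilityMeasure P]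

/-! The set `ℛ` must be the core of `ρ` on `L^∞(𝒢)`, and `𝔼^μ[X] + τ_μ(X)` must be the infimum over
`Y ∈ L^∞(𝒢)` of `ρ(X + Y) - 𝔼^μ[Y]`, which is `fiberSup`.

Existence: Hahn–Banach gives a linear `l ≤ ρ` with `l X = ρ X`. Lebesgue continuity makes `l` on
`L^∞(𝒢)` the expectation under some `μ` in the core, and `l X = l (X + Y) - 𝔼^μ[Y] ≤ ρ(X + Y) -
𝔼^μ[Y]`, so the supremum is attained at `μ` (`exists_fiberSup_eq`). The core is compact because it
consists of the restrictions of the linear functionals below `ρ`, a compact set by Tychonoff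
(`isCompact_coreSet`). Regularity holds because `fiberSup` is an infimum of affine `w`-continuous
functions of `μ`.

Uniqueness is Fenchel–Moreau duality. Adjustments vanish on `L^∞(𝒢)`, so `ρ` is there the support
function of `ℛ`, which determines a closed convex set (`eq_coreSet`). For fixed `X`, invariance
makes `Y ↦ ρ(X + Y)` a conjugate of `μ ↦ 𝔼^μ[X] + τ_μ(X)`; regularity says that this function is
concave and upper semicontinuous, so separation from its hypograph recovers it (`eq_fiberSup`). -/

theorem LInf.ae_norm_le (X : LInf P) : ∀ᵐ ω ∂P, ‖X ω‖ ≤ ‖X‖ := by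
  have h := ae_le_eLpNormEssSup (f := X) (μ := P)
  filter_upwards [h] with ω hω
  rw [Lp.norm_def, eLpNorm_exponent_top]
  have hfin : eLpNormEssSup X P ≠ ∞ := by
    rw [← eLpNorm_exponent_top]; exact Lp.eLpNorm_ne_top X
  have := ENNReal.toReal_mono hfin hω
  simpa using this

theorem stronglyMeasurable_density (μ : acSignedMeasures P h𝒢) :
    StronglyMeasurable[𝒢] (density μ) :=
  (@SignedMeasure.measurable_rnDeriv Ω 𝒢 _ _).stronglyMeasurable

theorem integrable_density (μ : acSignedMeasures P h𝒢) : Integrable (density μ) P :=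
  integrable_of_integrable_trim h𝒢 (@SignedMeasure.integrable_rnDeriv Ω 𝒢 _ _)

theorem setIntegral_density (μ : acSignedMeasures P h𝒢) {A : Set Ω} (hA : MeasurableSet[𝒢] A) :
    ∫ ω in A, density μ ω ∂P = (μ : @SignedMeasure Ω 𝒢) A := by
  rw [setIntegral_trim h𝒢 (stronglyMeasurable_density μ) hA]
  have h := @SignedMeasure.withDensityᵥ_rnDeriv_eq Ω 𝒢 (μ : @SignedMeasure Ω 𝒢) (P.trim h𝒢) _ μ.2
  unfold density
  rw [← withDensityᵥ_apply (@SignedMeasure.integrable_rnDeriv Ω 𝒢 _ _) hA]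
  exact congrArg (fun s : @SignedMeasure Ω 𝒢 => s A) h

theorem density_add (μ ν : acSignedMeasures P h𝒢) :
    density (μ + ν) =ᵐ[P] fun ω => density μ ω + density ν ω :=
  ae_eq_of_ae_eq_trim (@SignedMeasure.rnDeriv_add Ω 𝒢 μ.1 ν.1 (P.trim h𝒢) _ _ _)

theorem density_smul (c : ℝ) (μ : acSignedMeasures P h𝒢) :
    density (c • μ) =ᵐ[P] fun ω => c * density μ ω :=
  ae_eq_of_ae_eq_trim (@SignedMeasure.rnDeriv_smul Ω 𝒢 μ.1 (P.trim h𝒢) _ c)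

theorem integrable_density_mul (μ : acSignedMeasures P h𝒢) (X : LInf P) :
    Integrable (fun ω => density μ ω * X ω) P :=
  (integrable_density μ).mul_bdd (Lp.aestronglyMeasurable X) (LInf.ae_norm_le X)

/-- The bilinear pairing `(μ, X) ↦ 𝔼^μ[X]`. -/
noncomputable def expectₗ (P : Measure Ω) [IsProbabilityMeasure P] (h𝒢 : 𝒢 ≤ ℱ) :
    acSignedMeasures P h𝒢 →ₗ[ℝ] LInf P →ₗ[ℝ] ℝ :=
  LinearMap.mk₂ ℝ expect
    (fun μ ν X => by
      unfold expect
      rw [← integral_add (integrable_density_mul μ X) (integrable_density_mul ν X)]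
      refine integral_congr_ae ?_
      filter_upwards [density_add μ ν] with ω hω
      rw [hω, add_mul])
    (fun c μ X => by
      unfold expect
      rw [smul_eq_mul, ← integral_const_mul]
      refine integral_congr_ae ?_
      filter_upwards [density_smul c μ] with ω hω
      rw [hω, mul_assoc])
    (fun μ X Y => by
      unfold expect
      rw [← integral_add (integrable_density_mul μ X) (integrable_density_mul μ Y)]
      refine integral_congr_ae ?_
      filter_upwards [Lp.coeFn_add X Y] with ω hω
      rw [hω, Pi.add_apply, mul_add])
    (fun c μ X => by
      unfold expect
      rw [smul_eq_mul, ← integral_const_mul]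
      refine integral_congr_ae ?_
      filter_upwards [Lp.coeFn_smul c X] with ω hω
      rw [hω, Pi.smul_apply, smul_eq_mul, mul_left_comm])

@[simp] theorem expectₗ_apply (μ : acSignedMeasures P h𝒢) (X : LInf P) :
    expectₗ P h𝒢 μ X = expect μ X := rfl

theorem isLebesgueContinuous_expect (μ : acSignedMeasures P h𝒢) :
    IsLebesgueContinuous (expect μ) := by
  rintro Xs X ⟨⟨C, hC⟩, hlim⟩
  refine tendsto_integral_of_dominated_convergence (fun ω => ‖density μ ω‖ * C)
    (fun n => (integrable_density_mul μ (Xs n)).aestronglyMeasurable)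
    ((integrable_density μ).norm.mul_const C) (fun n => ?_) ?_
  · filter_upwards [LInf.ae_norm_le (Xs n)] with ω hω
    rw [norm_mul]
    exact mul_le_mul_of_nonneg_left (hω.trans (hC n)) (norm_nonneg _)
  · filter_upwards [hlim] with ω hω
    exact hω.const_mul _

/-- The class in `L^∞` of the indicator function of a measurable set. -/
noncomputable def ind (P : Measure Ω) [IsProbabilityMeasure P] {A : Set Ω} (hA : MeasurableSet A) :
    LInf P :=
  indicatorConstLp ∞ hA (measure_ne_top P A) (1 : ℝ)

theorem ind_coeFn {A : Set Ω} (hA : MeasurableSet A) :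
    ind P hA =ᵐ[P] A.indicator fun _ => (1 : ℝ) :=
  indicatorConstLp_coeFn

theorem expect_ind (μ : acSignedMeasures P h𝒢) {A : Set Ω} (hA : MeasurableSet[𝒢] A) :
    expect μ (ind P (h𝒢 A hA)) = (μ : @SignedMeasure Ω 𝒢) A := by
  rw [← setIntegral_density μ hA, ← integral_indicator (h𝒢 A hA)]
  refine integral_congr_ae ?_
  filter_upwards [ind_coeFn (P := P) (h𝒢 A hA)] with ω hω
  rw [hω]
  by_cases h : ω ∈ A <;> simp [h]

theorem norm_ind_le {A : Set Ω} (hA : MeasurableSet A) : ‖ind P hA‖ ≤ 1 := by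
  unfold ind
  simpa using norm_indicatorConstLp_le (p := ∞) (hs := hA) (hμs := measure_ne_top P A) (c := (1:ℝ))

theorem ind_mem_LInfSub {A : Set Ω} (hA : MeasurableSet[𝒢] A) :
    ind P (h𝒢 A hA) ∈ LInfSub 𝒢 P :=
  mem_lpMeas_indicatorConstLp h𝒢 hA (measure_ne_top P A)

theorem memLp_top_condExp (_h𝒢 : 𝒢 ≤ ℱ) (X : LInf P) : MemLp (P[X | 𝒢]) ∞ P := by
  refine memLp_top_of_bound (integrable_condExp.aestronglyMeasurable) ‖X‖ ?_
  have := ae_bdd_abs_condExp_of_ae_bdd_abs (m := 𝒢) (R := ‖X‖) (f := X) (μ := P)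
    (by simpa using LInf.ae_norm_le X)
  simpa using this

/-- The conditional expectation given `𝒢` as an element of `L^∞(𝒢)`. -/
noncomputable def condExpLInf (h𝒢 : 𝒢 ≤ ℱ) (X : LInf P) : LInfSub 𝒢 P :=
  ⟨(memLp_top_condExp h𝒢 X).toLp, stronglyMeasurable_condExp.aestronglyMeasurable.congr
    (memLp_top_condExp h𝒢 X).coeFn_toLp.symm⟩

/-- The density is `𝒢`-measurable, so it can be pulled out of the conditional expectation. -/
theorem expect_condExpLInf (μ : acSignedMeasures P h𝒢) (X : LInf P) :
    expect μ (condExpLInf h𝒢 X : LInf P) = expect μ X := by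
  have hX : Integrable X P := (Lp.memLp X).integrable le_top
  have h := condExp_mul_of_stronglyMeasurable_left (stronglyMeasurable_density μ)
    (integrable_density_mul μ X) hX
  unfold expect
  rw [← integral_condExp h𝒢 (f := fun ω => density μ ω * X ω)]
  refine integral_congr_ae ?_
  filter_upwards [h, (memLp_top_condExp h𝒢 X).coeFn_toLp] with ω h1 h2
  change density μ ω * ((memLp_top_condExp h𝒢 X).toLp _ : LInf P) ω = _
  rw [h2]
  exact h1.symm

theorem expect_injective {μ ν : acSignedMeasures P h𝒢}
    (h : ∀ Y ∈ LInfSub 𝒢 P, expect μ Y = expect ν Y) : μ = ν := by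
  refine Subtype.ext (VectorMeasure.ext fun A hA => ?_)
  rw [← expect_ind μ hA, ← expect_ind ν hA]
  exact h _ (ind_mem_LInfSub hA)

end Expectation

/-! ### Positive Lebesgue continuous functionals as measures. -/

section Representation

set_option linter.unusedSectionVars false

variable {Ω : Type u} {𝒢 : MeasurableSpace Ω} [ℱ : MeasurableSpace Ω]
  {P : Measure Ω} [IsProbabilityMeasure P]

theorem ind_congr {A B : Set Ω} {hA : MeasurableSet A} {hB : MeasurableSet B} (h : A = B) :
    ind P hA = ind P hB := by
  subst h; rfl

theorem ind_empty : ind P (MeasurableSet.empty : MeasurableSet (∅ : Set Ω)) = 0 :=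
  indicatorConstLp_empty

theorem ind_union {A B : Set Ω} (hA : MeasurableSet A) (hB : MeasurableSet B)
    (h : Disjoint A B) : ind P (hA.union hB) = ind P hA + ind P hB :=
  indicatorConstLp_disjoint_union hA hB _ _ h 1

theorem ind_nonneg {A : Set Ω} (hA : MeasurableSet A) : 0 ≤ ind P hA := by
  rw [← Lp.coeFn_nonneg]
  filter_upwards [ind_coeFn (P := P) hA] with ω hω
  rw [hω]
  exact Set.indicator_nonneg (fun _ _ => zero_le_one) ω

theorem boundedAETendsto_ind_biUnion {A : ℕ → Set Ω} (hA : ∀ i, MeasurableSet (A i)) :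
    BoundedAETendsto
      (fun n => ind P ((Finset.range n).measurableSet_biUnion fun i _ => hA i))
      (ind P (MeasurableSet.iUnion hA)) := by
  refine ⟨⟨1, fun n => norm_ind_le _⟩, ?_⟩
  have h1 : ∀ᵐ ω ∂P, ∀ n, ind P ((Finset.range n).measurableSet_biUnion fun i _ => hA i) ω =
      (⋃ i ∈ Finset.range n, A i).indicator (fun _ => (1 : ℝ)) ω :=
    ae_all_iff.2 fun n => ind_coeFn _
  filter_upwards [h1, ind_coeFn (P := P) (MeasurableSet.iUnion hA)] with ω h1 h2
  simp only [h1, h2]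
  exact ((tendsto_indicator_biUnion_finset A (fun _ => (1 : ℝ)) ω).comp
    tendsto_finset_range).mono_right (pure_le_nhds _)

/-- The signed measure `A ↦ ℓ(1_A)` on `𝒢` of a positive Lebesgue continuous linear functional. -/
noncomputable def toSignedMeasure (h𝒢 : 𝒢 ≤ ℱ) (l : LInf P →ₗ[ℝ] ℝ)
    (hpos : ∀ X, 0 ≤ X → 0 ≤ l X) (hl : IsLebesgueContinuous l) : @SignedMeasure Ω 𝒢 := by
  classical
  exact @VectorMeasure.mk Ω 𝒢 ℝ _ _
    (fun A => if hA : MeasurableSet[𝒢] A then l (ind P (h𝒢 A hA)) else 0)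
    (by simp [ind_empty])
    (fun A hA => by simp [hA])
    (fun A hA hdis => by
      have hA' := fun i => h𝒢 _ (hA i)
      have hU : MeasurableSet[𝒢] (⋃ i, A i) := MeasurableSet.iUnion hA
      simp only [hA, hU, dif_pos]
      -- Positivity makes all terms nonnegative, so convergence of the initial partial sums
      -- suffices; finite additivity turns these into values of `l` at indicators of finite unions.
      rw [hasSum_iff_tendsto_nat_of_nonneg fun i => hpos _ (ind_nonneg _)]
      have key : ∀ n, ∑ i ∈ Finset.range n, l (ind P (hA' i)) =
          l (ind P ((Finset.range n).measurableSet_biUnion fun i _ => hA' i)) := by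
        intro n
        induction n with
        | zero =>
          rw [Finset.sum_range_zero, ind_congr (hB := MeasurableSet.empty) (by simp), ind_empty,
            map_zero]
        | succ n ih =>
          rw [Finset.sum_range_succ, ih, ← map_add, ← ind_union]
          · exact congrArg l (ind_congr (by
              rw [Finset.range_add_one, Finset.set_biUnion_insert, Set.union_comm]))
          · simp only [Set.disjoint_iUnion_left]
            intro i hi
            exact hdis (Finset.mem_range.1 hi).ne
      exact Tendsto.congr (fun n => (key n).symm) (hl _ _ (boundedAETendsto_ind_biUnion hA')))

theorem toSignedMeasure_apply (h𝒢 : 𝒢 ≤ ℱ) {l : LInf P →ₗ[ℝ] ℝ}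
    (hpos : ∀ X, 0 ≤ X → 0 ≤ l X) (hl : IsLebesgueContinuous l) {A : Set Ω}
    (hA : MeasurableSet[𝒢] A) : toSignedMeasure h𝒢 l hpos hl A = l (ind P (h𝒢 A hA)) := by
  classical
  exact dif_pos hA

theorem toSignedMeasure_mem (h𝒢 : 𝒢 ≤ ℱ) {l : LInf P →ₗ[ℝ] ℝ}
    (hpos : ∀ X, 0 ≤ X → 0 ≤ l X) (hl : IsLebesgueContinuous l) :
    toSignedMeasure h𝒢 l hpos hl ∈ acSignedMeasures P h𝒢 := by
  refine @VectorMeasure.AbsolutelyContinuous.mk Ω 𝒢 _ _ _ _ _ _ _ _ fun A hA h0 => ?_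
  rw [Measure.toENNRealVectorMeasure_apply_measurable hA, trim_measurableSet_eq h𝒢 hA] at h0
  rw [toSignedMeasure_apply h𝒢 hpos hl hA]
  have : ind P (h𝒢 A hA) = 0 := by
    refine Lp.ext ?_
    filter_upwards [ind_coeFn (P := P) (h𝒢 A hA), Lp.coeFn_zero ℝ ∞ P,
      measure_eq_zero_iff_ae_notMem.1 h0] with ω h1 h2 h3
    rw [h1, h2, Set.indicator_of_notMem h3, Pi.zero_apply]
  rw [this, map_zero]

theorem memLp_top_simpleFunc (h𝒢 : 𝒢 ≤ ℱ) (s : @SimpleFunc Ω 𝒢 ℝ) : MemLp s ∞ P := by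
  obtain ⟨C, hC⟩ := @SimpleFunc.exists_forall_norm_le Ω ℝ 𝒢 _ s
  exact memLp_top_of_bound ((@SimpleFunc.stronglyMeasurable Ω ℝ 𝒢 _ s).mono h𝒢).aestronglyMeasurable
    C (Eventually.of_forall hC)

/-- Linearity passes from indicators to simple functions; Lebesgue continuity then passes to the
limit along simple functions cut off at `‖Y‖`, which keeps the sequence uniformly bounded. -/
theorem eq_of_eq_on_ind (h𝒢 : 𝒢 ≤ ℱ) {l m : LInf P →ₗ[ℝ] ℝ}
    (hl : IsLebesgueContinuous l) (hm : IsLebesgueContinuous m)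
    (h : ∀ (A : Set Ω) (hA : MeasurableSet[𝒢] A), l (ind P (h𝒢 A hA)) = m (ind P (h𝒢 A hA)))
    {Y : LInf P} (hY : Y ∈ LInfSub 𝒢 P) : l Y = m Y := by
  have simple : ∀ s : @SimpleFunc Ω 𝒢 ℝ, ∀ Z : LInf P, Z =ᵐ[P] s → l Z = m Z := by
    intro s
    induction s using SimpleFunc.induction with
    | @const c A hA =>
      intro Z hZ
      have : Z = c • ind P (h𝒢 A hA) := by
        refine Lp.ext ?_
        filter_upwards [hZ, ind_coeFn (P := P) (h𝒢 A hA), Lp.coeFn_smul c (ind P (h𝒢 A hA))]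
          with ω h1 h2 h3
        rw [h1, h3, Pi.smul_apply, h2]
        by_cases hω : ω ∈ A <;> simp [hω]
      rw [this, map_smul, map_smul, h A hA]
    | @add f g _ hf hg =>
      intro Z hZ
      have h1 := (memLp_top_simpleFunc (P := P) h𝒢 f).coeFn_toLp
      have h2 := (memLp_top_simpleFunc (P := P) h𝒢 g).coeFn_toLp
      have : Z = (memLp_top_simpleFunc (P := P) h𝒢 f).toLp _ +
          (memLp_top_simpleFunc (P := P) h𝒢 g).toLp _ := by
        refine Lp.ext ?_
        refine EventuallyEq.trans ?_ (Lp.coeFn_add _ _).symm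
        filter_upwards [hZ, h1, h2] with ω h1 h2 h3
        rw [h1, Pi.add_apply, h2, h3]
        rfl
      rw [this, map_add, map_add, hf _ h1, hg _ h2]
  have hYm : AEStronglyMeasurable[𝒢] Y P := hY
  have hg := hYm.stronglyMeasurable_mk
  have hb : ∀ᵐ ω ∂P, ‖hYm.mk Y ω‖ ≤ ‖Y‖ := by
    filter_upwards [hYm.ae_eq_mk, LInf.ae_norm_le Y] with ω h1 h2
    rwa [← h1]
  have hlim := hg.tendsto_approxBounded_ae hb
  let Zs : ℕ → LInf P := fun n => (memLp_top_simpleFunc (P := P) h𝒢 (hg.approxBounded ‖Y‖ n)).toLp _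
  have hZs : ∀ n, Zs n =ᵐ[P] hg.approxBounded ‖Y‖ n := fun n => MemLp.coeFn_toLp _
  have hB : BoundedAETendsto Zs Y := by
    refine ⟨⟨‖Y‖, fun n => ?_⟩, ?_⟩
    · have hn : ∀ᵐ ω ∂P, ‖Zs n ω‖ ≤ ‖Y‖ := by
        filter_upwards [hZs n] with ω hω
        rw [hω]
        exact hg.norm_approxBounded_le (norm_nonneg _) n ω
      simpa using Lp.norm_le_of_ae_bound (norm_nonneg _) hn
    · filter_upwards [hlim, ae_all_iff.2 hZs, hYm.ae_eq_mk] with ω h1 h2 h3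
      simpa only [h2, h3] using h1
  refine tendsto_nhds_unique (hl _ _ hB) ?_
  simpa only [simple _ _ (hZs _)] using hm _ _ hB

/-- Positive Lebesgue continuous linear functionals are given on `L^∞(𝒢)` by a measure. -/
theorem exists_expect_eq (h𝒢 : 𝒢 ≤ ℱ) (l : LInf P →ₗ[ℝ] ℝ)
    (hpos : ∀ X, 0 ≤ X → 0 ≤ l X) (hl : IsLebesgueContinuous l) :
    ∃ μ : acSignedMeasures P h𝒢, ∀ Y ∈ LInfSub 𝒢 P, expect μ Y = l Y := by
  refine ⟨⟨_, toSignedMeasure_mem h𝒢 hpos hl⟩, fun Y hY => ?_⟩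
  refine eq_of_eq_on_ind h𝒢 (l := expectₗ P h𝒢 _) (isLebesgueContinuous_expect _) hl
    (fun A hA => ?_) hY
  rw [expectₗ_apply, expect_ind _ hA]
  exact toSignedMeasure_apply h𝒢 hpos hl hA

end Representation

/-! ### Sublinear functionals, Hahn–Banach and compactness. -/

section Sublinear

variable {Ω : Type u} [MeasurableSpace Ω] {P : Measure Ω} {f g ρ : LInf P → ℝ}

theorem IsPosHomogeneous.map_zero (hp : IsPosHomogeneous f) : f 0 = 0 := by
  simpa using hp 0 0 le_rfl

theorem IsConvexFunctional.map_add_le (hc : IsConvexFunctional f) (hp : IsPosHomogeneous f)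
    (X Y : LInf P) : f (X + Y) ≤ f X + f Y := by
  have h := hc ((2 : ℝ) • X) ((2 : ℝ) • Y) (1 / 2) (by norm_num) (by norm_num)
  rw [hp _ _ zero_le_two, hp _ _ zero_le_two, smul_smul, smul_smul] at h
  norm_num at h
  linarith

theorem IsPosHomogeneous.isConvexFunctional (hp : IsPosHomogeneous f)
    (hadd : ∀ X Y, f (X + Y) ≤ f X + f Y) : IsConvexFunctional f := by
  intro X Y c h0 h1
  have h := hadd (c • X) ((1 - c) • Y)
  rwa [hp _ _ h0, hp _ _ (sub_nonneg.2 h1)] at h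

theorem isPosHomogeneous_of_forall_pos_le (h0 : f 0 = 0)
    (h : ∀ (X : LInf P) (c : ℝ), 0 < c → f (c • X) ≤ c * f X) : IsPosHomogeneous f := by
  intro X c hc
  rcases hc.eq_or_lt with rfl | hc
  · simp [h0]
  · refine (h X c hc).antisymm ?_
    have h' := h (c • X) c⁻¹ (inv_pos.2 hc)
    rw [inv_smul_smul₀ hc.ne'] at h'
    calc c * f X ≤ c * (c⁻¹ * f (c • X)) := mul_le_mul_of_nonneg_left h' hc.le
      _ = f (c • X) := mul_inv_cancel_left₀ hc.ne' _

theorem BoundedAETendsto.sub_const {Xs : ℕ → LInf P} {X : LInf P} (h : BoundedAETendsto Xs X) :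
    BoundedAETendsto (fun n => Xs n - X) 0 := by
  obtain ⟨⟨C, hC⟩, hlim⟩ := h
  refine ⟨⟨C + ‖X‖, fun n => (norm_sub_le _ _).trans (by gcongr; exact hC n)⟩, ?_⟩
  filter_upwards [hlim, ae_all_iff.2 fun n => Lp.coeFn_sub (Xs n) X, Lp.coeFn_zero ℝ ∞ P]
    with ω h1 h2 h3
  simp only [h2, h3, Pi.sub_apply, Pi.zero_apply]
  simpa using h1.sub_const (X ω)

theorem BoundedAETendsto.const_sub {Xs : ℕ → LInf P} {X : LInf P} (h : BoundedAETendsto Xs X) :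
    BoundedAETendsto (fun n => X - Xs n) 0 := by
  obtain ⟨⟨C, hC⟩, hlim⟩ := h.sub_const
  refine ⟨⟨C, fun n => by rw [norm_sub_rev]; exact hC n⟩, ?_⟩
  filter_upwards [hlim, ae_all_iff.2 fun n => Lp.coeFn_sub (Xs n) X,
    ae_all_iff.2 fun n => Lp.coeFn_sub X (Xs n), Lp.coeFn_zero ℝ ∞ P] with ω h1 h2 h3 h4
  simp only [h2, h3, h4, Pi.sub_apply, Pi.zero_apply] at h1 ⊢
  simpa using h1.neg

/-- Subadditivity gives `-ρ(X - X_n) ≤ f(X_n) - f(X) ≤ ρ(X_n - X)`, and both bounds tend to `ρ 0 =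
0`. This serves for linear functionals below `ρ` and for `fiberSup`. -/
theorem IsLebesgueContinuous.of_le (hρ : IsLebesgueContinuous ρ) (h0 : ρ 0 = 0)
    (hadd : ∀ X Y, f (X + Y) ≤ f X + f Y) (hle : ∀ X, f X ≤ ρ X) : IsLebesgueContinuous f := by
  intro Xs X h
  have h1 := hρ _ _ h.sub_const
  have h2 := hρ _ _ h.const_sub
  rw [h0] at h1 h2
  refine tendsto_of_tendsto_of_tendsto_of_le_of_le (g := fun n => f X - ρ (X - Xs n))
    (h := fun n => f X + ρ (Xs n - X)) (by simpa using h2.const_sub (f X))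
    (by simpa using h1.const_add (f X)) (fun n => ?_) (fun n => ?_)
  · have := hadd (Xs n) (X - Xs n)
    rw [add_sub_cancel] at this
    simp only
    linarith [hle (X - Xs n)]
  · have := hadd X (Xs n - X)
    rw [add_sub_cancel] at this
    simp only
    linarith [hle (Xs n - X)]

theorem IsLebesgueContinuous.sub (hf : IsLebesgueContinuous f) (hg : IsLebesgueContinuous g) :
    IsLebesgueContinuous fun X => f X - g X :=
  fun Xs X h => (hf Xs X h).sub (hg Xs X h)

theorem IsLebesgueContinuous.isFatouContinuous (hf : IsLebesgueContinuous f) :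
    IsFatouContinuous f := fun Xs X h =>
  (((continuous_coe_real_ereal.tendsto _).comp (hf Xs X h)).liminf_eq).ge

namespace IsCoherentRiskMeasure

variable [IsFiniteMeasure P]

theorem map_add_le (hρ : IsCoherentRiskMeasure ρ) (X Y : LInf P) : ρ (X + Y) ≤ ρ X + ρ Y :=
  hρ.convex.map_add_le hρ.pos_homogeneous X Y

theorem map_zero (hρ : IsCoherentRiskMeasure ρ) : ρ 0 = 0 := hρ.pos_homogeneous.map_zero

theorem neg_map_neg_le (hρ : IsCoherentRiskMeasure ρ) (X : LInf P) : -ρ (-X) ≤ ρ X := by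
  have := hρ.map_add_le X (-X)
  rw [add_neg_cancel, hρ.map_zero] at this
  linarith

theorem linear_nonneg (hρ : IsCoherentRiskMeasure ρ) {l : LInf P →ₗ[ℝ] ℝ} (hl : ∀ X, l X ≤ ρ X)
    {X : LInf P} (hX : 0 ≤ X) : 0 ≤ l X := by
  have h1 := hl (-X)
  have h2 := hρ.monotone (-X) 0 (neg_nonpos.2 hX)
  rw [hρ.map_zero] at h2
  rw [_root_.map_neg] at h1
  linarith

theorem linear_isLebesgueContinuous (hρ : IsCoherentRiskMeasure ρ)
    (hρL : IsLebesgueContinuous ρ) {l : LInf P →ₗ[ℝ] ℝ} (hl : ∀ X, l X ≤ ρ X) :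
    IsLebesgueContinuous l :=
  hρL.of_le hρ.map_zero (fun X Y => (map_add l X Y).le) hl

theorem exists_linear_extension (hρ : IsCoherentRiskMeasure ρ) (S : Submodule ℝ (LInf P))
    (φ : S →ₗ[ℝ] ℝ) (hφ : ∀ Y : S, φ Y ≤ ρ Y) :
    ∃ l : LInf P →ₗ[ℝ] ℝ, (∀ Y : S, l Y = φ Y) ∧ ∀ X, l X ≤ ρ X :=
  exists_extension_of_le_sublinear ⟨S, φ⟩ ρ (fun c hc X => hρ.pos_homogeneous X c hc.le)
    hρ.map_add_le hφ

theorem exists_linear_eq (hρ : IsCoherentRiskMeasure ρ) (X : LInf P) :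
    ∃ l : LInf P →ₗ[ℝ] ℝ, (∀ Z, l Z ≤ ρ Z) ∧ l X = ρ X := by
  rcases eq_or_ne X 0 with rfl | hX
  · obtain ⟨l, -, hl⟩ := hρ.exists_linear_extension ⊥ (0 : (⊥ : Submodule ℝ (LInf P)) →ₗ[ℝ] ℝ) fun Y => by
      rw [(Submodule.mem_bot ℝ).1 Y.2, hρ.map_zero]; simp
    exact ⟨l, hl, by rw [hρ.map_zero, _root_.map_zero]⟩
  · let φ : LInf P →ₗ.[ℝ] ℝ := LinearPMap.mkSpanSingleton X (ρ X) hX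
    have hφ : ∀ (c : ℝ) (h : c • X ∈ φ.domain), φ ⟨c • X, h⟩ = c * ρ X := fun c h =>
      LinearPMap.mkSpanSingleton'_apply X (ρ X) _ c h
    obtain ⟨l, h1, h2⟩ := hρ.exists_linear_extension φ.domain φ.toFun (by
      rintro ⟨Y, hY⟩
      obtain ⟨c, rfl⟩ := Submodule.mem_span_singleton.1 hY
      refine (hφ c hY).trans_le ?_
      rcases le_total 0 c with hc | hc
      · exact (hρ.pos_homogeneous X c hc).ge
      -- For negative `c`, homogeneity applies to `-c`: `c ρ(X) = -ρ(-(c X)) ≤ ρ(c X)`.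
      · have h := hρ.neg_map_neg_le (c • X)
        rw [← neg_smul, hρ.pos_homogeneous X (-c) (neg_nonneg.2 hc)] at h
        simp only
        linarith)
    refine ⟨l, h2, ?_⟩
    have hX1 : (1 : ℝ) • X ∈ φ.domain := Submodule.mem_span_singleton.2 ⟨1, rfl⟩
    have := (h1 ⟨_, hX1⟩).trans (hφ 1 hX1)
    simpa using this

end IsCoherentRiskMeasure

/-- The linear functionals dominated by `ρ` form a compact set of functions on `L^∞`. -/
theorem isCompact_dominated (ρ : LInf P → ℝ) :
    IsCompact {f : LInf P → ℝ | ∃ l : LInf P →ₗ[ℝ] ℝ, (∀ X, l X ≤ ρ X) ∧ ⇑l = f} := by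
  -- Linear functionals below `ρ` take values in `[-ρ(-X), ρ(X)]` at `X`. In this Tychonoff box they
  -- are cut out by the closed conditions of linearity.
  have hK : IsCompact (Set.univ.pi fun X : LInf P => Set.Icc (-ρ (-X)) (ρ X)) :=
    isCompact_univ_pi fun X => isCompact_Icc
  have hC : IsClosed {f : LInf P → ℝ | (∀ X Y, f (X + Y) = f X + f Y) ∧
      ∀ (c : ℝ) (X : LInf P), f (c • X) = c • f X} := by
    simp only [Set.ofPred_and, Set.ofPred_forall]
    refine IsClosed.inter (isClosed_iInter fun X => isClosed_iInter fun Y => ?_)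
      (isClosed_iInter fun c => isClosed_iInter fun X => ?_)
    · exact isClosed_eq (by fun_prop) (by fun_prop)
    · exact isClosed_eq (by fun_prop) (by fun_prop)
  convert hK.inter_right hC using 1
  ext f
  constructor
  · rintro ⟨l, hl, rfl⟩
    refine ⟨fun X _ => ⟨?_, hl X⟩, map_add l, map_smul l⟩
    have := hl (-X)
    rw [map_neg] at this
    linarith
  · rintro ⟨h1, h2, h3⟩
    exact ⟨⟨⟨f, h2⟩, h3⟩, fun X => (h1 X trivial).2, rfl⟩

end Sublinear

/-! ### Existence: the core and its adjustments. -/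

section Core

set_option linter.unusedSectionVars false

variable {Ω : Type u} {𝒢 : MeasurableSpace Ω} [ℱ : MeasurableSpace Ω] {h𝒢 : 𝒢 ≤ ℱ}
  {P : Measure Ω} [IsProbabilityMeasure P] {ρ : LInf P → ℝ}

/-- The measures on `𝒢` that are dominated by `ρ` on `L^∞(𝒢)`. -/
def coreSet (h𝒢 : 𝒢 ≤ ℱ) (ρ : LInf P → ℝ) : Set (acSignedMeasures P h𝒢) :=
  {μ | ∀ Y ∈ LInfSub 𝒢 P, expect μ Y ≤ ρ Y}

/-- The largest functional dominated by `ρ` that is translated by `𝔼^μ[Y]` along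
every `Y ∈ L^∞(𝒢)`. -/
noncomputable def fiberSup (ρ : LInf P → ℝ) (μ : acSignedMeasures P h𝒢) (X : LInf P) : ℝ :=
  ⨅ Y : LInfSub 𝒢 P, (ρ (X + Y) - expect μ (Y : LInf P))

theorem expect_add (μ : acSignedMeasures P h𝒢) (X Y : LInf P) :
    expect μ (X + Y) = expect μ X + expect μ Y := map_add (expectₗ P h𝒢 μ) X Y

theorem expect_sub (μ : acSignedMeasures P h𝒢) (X Y : LInf P) :
    expect μ (X - Y) = expect μ X - expect μ Y := map_sub (expectₗ P h𝒢 μ) X Y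

theorem expect_neg (μ : acSignedMeasures P h𝒢) (X : LInf P) :
    expect μ (-X) = -expect μ X := map_neg (expectₗ P h𝒢 μ) X

theorem expect_smul (μ : acSignedMeasures P h𝒢) (c : ℝ) (X : LInf P) :
    expect μ (c • X) = c * expect μ X := map_smul (expectₗ P h𝒢 μ) c X

theorem expect_zero (μ : acSignedMeasures P h𝒢) : expect μ (0 : LInf P) = 0 :=
  map_zero (expectₗ P h𝒢 μ)

theorem expect_smul_add_smul (μ ν : acSignedMeasures P h𝒢) (a b : ℝ) (X : LInf P) :
    expect (a • μ + b • ν) X = a * expect μ X + b * expect ν X := by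
  simp only [← expectₗ_apply, map_add, map_smul, LinearMap.add_apply, LinearMap.smul_apply,
    smul_eq_mul]

theorem convex_coreSet : Convex ℝ (coreSet h𝒢 ρ) := by
  intro μ hμ ν hν a b ha hb hab Y hY
  rw [expect_smul_add_smul]
  calc a * expect μ Y + b * expect ν Y ≤ a * ρ Y + b * ρ Y :=
        add_le_add (mul_le_mul_of_nonneg_left (hμ Y hY) ha)
          (mul_le_mul_of_nonneg_left (hν Y hY) hb)
    _ = ρ Y := by rw [← add_mul, hab, one_mul]

/-- Testing with `-1_A` and monotonicity give positivity; testing with the constants `1` and `-1`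
and cash invariance give total mass one. -/
theorem coreSet_subset_acProbabilities (hρ : IsCoherentRiskMeasure ρ) :
    coreSet h𝒢 ρ ⊆ acProbabilities P h𝒢 := by
  intro μ hμ
  refine ⟨fun A hA => ?_, ?_⟩
  · rw [← expect_ind μ hA]
    have h1 := hμ _ (neg_mem (ind_mem_LInfSub (P := P) (h𝒢 := h𝒢) hA))
    have h2 := hρ.monotone (-ind P (h𝒢 A hA)) 0 (neg_nonpos.2 (ind_nonneg _))
    rw [expect_neg] at h1
    rw [hρ.map_zero] at h2
    linarith
  · have hU : MeasurableSet[𝒢] (Set.univ : Set Ω) := @MeasurableSet.univ Ω 𝒢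
    rw [← expect_ind μ hU]
    have hc : ind P (h𝒢 _ hU) = Lp.const ∞ P 1 := indicatorConstLp_univ ∞ P 1
    have h1 := hμ _ (ind_mem_LInfSub (P := P) (h𝒢 := h𝒢) hU)
    have h2 := hμ _ (neg_mem (ind_mem_LInfSub (P := P) (h𝒢 := h𝒢) hU))
    have h3 := hρ.cash_invariant 0 1
    have h4 := hρ.cash_invariant 0 (-1)
    rw [zero_add, hρ.map_zero] at h3 h4
    rw [expect_neg] at h2
    rw [hc] at h1 h2 ⊢
    rw [map_neg] at h4
    linarith

theorem fiberSup_bddBelow (hρ : IsCoherentRiskMeasure ρ) {μ : acSignedMeasures P h𝒢}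
    (hμ : μ ∈ coreSet h𝒢 ρ) (X : LInf P) :
    BddBelow (Set.range fun Y : LInfSub 𝒢 P => ρ (X + Y) - expect μ (Y : LInf P)) := by
  -- `𝔼^μ[Y] ≤ ρ(Y) ≤ ρ(X + Y) + ρ(-X)`.
  refine ⟨-ρ (-X), ?_⟩
  rintro _ ⟨Y, rfl⟩
  have h1 := hμ _ Y.2
  have h2 := hρ.map_add_le (X + Y) (-X)
  rw [add_neg_cancel_comm] at h2
  simp only
  linarith

theorem fiberSup_le (hρ : IsCoherentRiskMeasure ρ) {μ : acSignedMeasures P h𝒢}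
    (hμ : μ ∈ coreSet h𝒢 ρ) (X : LInf P) {Y : LInf P} (hY : Y ∈ LInfSub 𝒢 P) :
    fiberSup ρ μ X ≤ ρ (X + Y) - expect μ Y :=
  ciInf_le (fiberSup_bddBelow hρ hμ X) ⟨Y, hY⟩

theorem le_fiberSup {μ : acSignedMeasures P h𝒢} {X : LInf P} {a : ℝ}
    (h : ∀ Y ∈ LInfSub 𝒢 P, a ≤ ρ (X + Y) - expect μ Y) : a ≤ fiberSup ρ μ X :=
  le_ciInf fun Y => h Y Y.2

theorem fiberSup_le_self (hρ : IsCoherentRiskMeasure ρ) {μ : acSignedMeasures P h𝒢}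
    (hμ : μ ∈ coreSet h𝒢 ρ) (X : LInf P) : fiberSup ρ μ X ≤ ρ X := by
  simpa [expect_zero] using fiberSup_le hρ hμ X (zero_mem (LInfSub 𝒢 P))

theorem fiberSup_add_le (hρ : IsCoherentRiskMeasure ρ) {μ : acSignedMeasures P h𝒢}
    (hμ : μ ∈ coreSet h𝒢 ρ) (X X' : LInf P) :
    fiberSup ρ μ (X + X') ≤ fiberSup ρ μ X + fiberSup ρ μ X' := by
  rw [← sub_le_iff_le_add]
  refine le_fiberSup fun Y hY => ?_
  rw [sub_le_comm]
  refine le_fiberSup fun Y' hY' => ?_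
  have h1 := fiberSup_le hρ hμ (X + X') (add_mem hY hY')
  have h2 := hρ.map_add_le (X + Y) (X' + Y')
  rw [add_add_add_comm] at h2
  rw [expect_add] at h1
  linarith

theorem isPosHomogeneous_fiberSup (hρ : IsCoherentRiskMeasure ρ) {μ : acSignedMeasures P h𝒢}
    (hμ : μ ∈ coreSet h𝒢 ρ) : IsPosHomogeneous (fiberSup ρ μ) := by
  refine isPosHomogeneous_of_forall_pos_le ?_ fun X c hc => ?_
  · refine ((fiberSup_le_self hρ hμ 0).trans hρ.map_zero.le).antisymm (le_fiberSup fun Y hY => ?_)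
    rw [zero_add]
    exact sub_nonneg.2 (hμ Y hY)
  · rw [← div_le_iff₀' hc]
    refine le_fiberSup fun Y hY => ?_
    rw [div_le_iff₀' hc]
    have h := fiberSup_le hρ hμ (c • X) (Submodule.smul_mem _ c hY)
    rw [← smul_add, hρ.pos_homogeneous _ _ hc.le, expect_smul] at h
    linarith

theorem fiberSup_mono (hρ : IsCoherentRiskMeasure ρ) {μ : acSignedMeasures P h𝒢}
    (hμ : μ ∈ coreSet h𝒢 ρ) {X X' : LInf P} (h : X ≤ X') : fiberSup ρ μ X ≤ fiberSup ρ μ X' :=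
  le_fiberSup fun Y hY => (fiberSup_le hρ hμ X hY).trans
    (sub_le_sub_right (hρ.monotone _ _ (add_le_add_left h Y)) _)

/-- Test functions `Y` for `X` correspond to test functions `Y - Z` for `X + Z`. This yields the
invariance of the adjustments along `L^∞(𝒢)`. -/
theorem fiberSup_add_le_of_mem (hρ : IsCoherentRiskMeasure ρ) {μ : acSignedMeasures P h𝒢}
    (hμ : μ ∈ coreSet h𝒢 ρ) (X : LInf P) {Z : LInf P} (hZ : Z ∈ LInfSub 𝒢 P) :
    fiberSup ρ μ (X + Z) ≤ fiberSup ρ μ X + expect μ Z := by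
  rw [← sub_le_iff_le_add]
  refine le_fiberSup fun Y hY => ?_
  have h := fiberSup_le hρ hμ (X + Z) (sub_mem hY hZ)
  rw [add_assoc, add_sub_cancel, expect_sub] at h
  linarith

theorem fiberSup_add_of_mem (hρ : IsCoherentRiskMeasure ρ) {μ : acSignedMeasures P h𝒢}
    (hμ : μ ∈ coreSet h𝒢 ρ) (X : LInf P) {Z : LInf P} (hZ : Z ∈ LInfSub 𝒢 P) :
    fiberSup ρ μ (X + Z) = fiberSup ρ μ X + expect μ Z := by
  refine (fiberSup_add_le_of_mem hρ hμ X hZ).antisymm ?_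
  have h := fiberSup_add_le_of_mem hρ hμ (X + Z) (neg_mem hZ)
  rw [add_neg_cancel_right, expect_neg] at h
  linarith

theorem fiberSup_concave (hρ : IsCoherentRiskMeasure ρ) {μ ν : acSignedMeasures P h𝒢}
    (hμ : μ ∈ coreSet h𝒢 ρ) (hν : ν ∈ coreSet h𝒢 ρ) {c : ℝ} (h0 : 0 ≤ c) (h1 : c ≤ 1)
    (X : LInf P) :
    c * fiberSup ρ μ X + (1 - c) * fiberSup ρ ν X ≤ fiberSup ρ (c • μ + (1 - c) • ν) X := by
  refine le_fiberSup fun Y hY => ?_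
  rw [expect_smul_add_smul]
  have h2 := mul_le_mul_of_nonneg_left (fiberSup_le hρ hμ X hY) h0
  have h3 := mul_le_mul_of_nonneg_left (fiberSup_le hρ hν X hY) (sub_nonneg.2 h1)
  linarith

/-- The topology tests only against `L^∞(𝒢)`; replacing `X` by its conditional expectation extends
the convergence to all of `L^∞`. -/
theorem tendsto_expect {Λ : Type*} {F : Filter Λ} {m : Λ → acSignedMeasures P h𝒢}
    {μ : acSignedMeasures P h𝒢} (h : Tendsto m F (@nhds _ (weakTopology P h𝒢) μ)) (X : LInf P) :
    Tendsto (fun i => expect (m i) X) F (𝓝 (expect μ X)) := by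
  rw [nhds_induced, tendsto_comap_iff, tendsto_pi_nhds] at h
  simpa only [Function.comp_apply, expect_condExpLInf] using h (condExpLInf h𝒢 X)

theorem exists_mem_coreSet (hρ : IsCoherentRiskMeasure ρ) (hρL : IsLebesgueContinuous ρ)
    {l : LInf P →ₗ[ℝ] ℝ} (hl : ∀ X, l X ≤ ρ X) :
    ∃ μ ∈ coreSet h𝒢 ρ, ∀ Y ∈ LInfSub 𝒢 P, expect μ Y = l Y := by
  obtain ⟨μ, hμ⟩ := exists_expect_eq h𝒢 l (fun X hX => hρ.linear_nonneg hl hX)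
    (hρ.linear_isLebesgueContinuous hρL hl)
  exact ⟨μ, fun Y hY => (hμ Y hY).trans_le (hl Y), hμ⟩

theorem exists_fiberSup_eq (hρ : IsCoherentRiskMeasure ρ) (hρL : IsLebesgueContinuous ρ)
    (X : LInf P) : ∃ μ ∈ coreSet h𝒢 ρ, fiberSup ρ μ X = ρ X := by
  obtain ⟨l, hl, hX⟩ := hρ.exists_linear_eq X
  obtain ⟨μ, hμ, hY⟩ := exists_mem_coreSet (h𝒢 := h𝒢) hρ hρL hl
  refine ⟨μ, hμ, (fiberSup_le_self hρ hμ X).antisymm (le_fiberSup fun Y hYm => ?_)⟩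
  have h := hl (X + Y)
  rw [map_add] at h
  rw [hY Y hYm]
  linarith

/-- Restriction to `L^∞(𝒢)` carries the compact set of linear functionals below `ρ` onto the core:
Hahn–Banach extends each core measure, and Lebesgue continuity represents each restriction by a
measure. -/
theorem isCompact_coreSet (hρ : IsCoherentRiskMeasure ρ) (hρL : IsLebesgueContinuous ρ) :
    @IsCompact _ (weakTopology P h𝒢) (coreSet h𝒢 ρ) := by
  let _ := weakTopology P h𝒢
  have hind : IsInducing fun (μ : acSignedMeasures P h𝒢) (Y : LInfSub 𝒢 P) =>
    expect μ (Y : LInf P) := ⟨rfl⟩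
  rw [hind.isCompact_iff]
  have hcont : Continuous fun (f : LInf P → ℝ) (Y : LInfSub 𝒢 P) => f Y := by fun_prop
  convert (isCompact_dominated ρ).image hcont using 1
  ext φ
  constructor
  · rintro ⟨μ, hμ, rfl⟩
    obtain ⟨l, h1, h2⟩ := hρ.exists_linear_extension (LInfSub 𝒢 P)
      ((expectₗ P h𝒢 μ).domRestrict _) fun Y => hμ Y Y.2
    exact ⟨l, ⟨l, h2, rfl⟩, funext h1⟩
  · rintro ⟨_, ⟨l, hl, rfl⟩, rfl⟩
    obtain ⟨μ, hμ, h⟩ := exists_mem_coreSet (h𝒢 := h𝒢) hρ hρL hl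
    exact ⟨μ, hμ, funext fun Y => h Y Y.2⟩

/-- The coherent adjustments induced by a coherent risk measure. -/
noncomputable def coreAssignment (h𝒢 : 𝒢 ≤ ℱ) (ρ : LInf P → ℝ) (μ : coreSet h𝒢 ρ) (X : LInf P) :
    ℝ :=
  fiberSup ρ (μ : acSignedMeasures P h𝒢) X - expect (μ : acSignedMeasures P h𝒢) X

theorem isLebesgueContinuous_coreAssignment (hρ : IsCoherentRiskMeasure ρ)
    (hρL : IsLebesgueContinuous ρ) (μ : coreSet h𝒢 ρ) :
    IsLebesgueContinuous (coreAssignment h𝒢 ρ μ) :=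
  (hρL.of_le hρ.map_zero (fiberSup_add_le hρ μ.2) (fiberSup_le_self hρ μ.2)).sub
    (isLebesgueContinuous_expect _)

theorem isCAAssignment_coreAssignment (hρ : IsCoherentRiskMeasure ρ)
    (hρL : IsLebesgueContinuous ρ) : IsCAAssignment (coreSet h𝒢 ρ) (coreAssignment h𝒢 ρ) := by
  intro μ
  have hhom : IsPosHomogeneous (coreAssignment h𝒢 ρ μ) := fun X c hc => by
    simp only [coreAssignment, isPosHomogeneous_fiberSup hρ μ.2 X c hc, expect_smul, mul_sub]
  refine ⟨⟨fun X Y hY => ?_, fun X Y hXY => ?_, ?_, hhom⟩,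
    (isLebesgueContinuous_coreAssignment hρ hρL μ).isFatouContinuous⟩
  · simp only [coreAssignment, fiberSup_add_of_mem hρ μ.2 X hY, expect_add]
    ring
  · simpa only [coreAssignment, add_sub_cancel] using fiberSup_mono hρ μ.2 hXY
  · refine hhom.isConvexFunctional fun X Y => ?_
    have := fiberSup_add_le hρ μ.2 X Y
    simp only [coreAssignment, expect_add]
    linarith

theorem isRegularAssignment_coreAssignment (hρ : IsCoherentRiskMeasure ρ) :
    IsRegularAssignment (coreSet h𝒢 ρ) (coreAssignment h𝒢 ρ) where
  concave := by
    rintro X μ₁ μ₂ ⟨_, hμ⟩ c h0 h1 rfl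
    have := fiberSup_concave hρ μ₁.2 μ₂.2 h0.le h1.le X
    simp only [coreAssignment, expect_smul_add_smul]
    linarith
  semicontinuous := by
    intro Λ _ _ _ m μ hm X
    refine EReal.le_of_forall_lt_iff_le.1 fun z hz => ?_
    rw [EReal.coe_lt_coe_iff, coreAssignment, sub_lt_iff_lt_add] at hz
    -- One fixed `Y` nearly attains the infimum at `μ`; along the net it gives an upper bound that
    -- converges.
    obtain ⟨Y, hY⟩ := exists_lt_of_ciInf_lt hz
    have hlim : Tendsto (fun i => ((ρ (X + Y) - expect (m i : acSignedMeasures P h𝒢) (Y : LInf P) -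
        expect (m i : acSignedMeasures P h𝒢) X : ℝ) : EReal)) atTop (𝓝 _) :=
      (continuous_coe_real_ereal.tendsto _).comp
        (((tendsto_expect hm Y).const_sub _).sub (tendsto_expect hm X))
    calc _ ≤ liminf (fun i => ((ρ (X + Y) - expect (m i : acSignedMeasures P h𝒢) (Y : LInf P) -
            expect (m i : acSignedMeasures P h𝒢) X : ℝ) : EReal)) atTop :=
          liminf_le_liminf (Eventually.of_forall fun i => EReal.coe_le_coe_iff.2
            (sub_le_sub_right (fiberSup_le hρ (m i).2 X Y.2) _))
      _ = _ := hlim.liminf_eq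
      _ ≤ z := EReal.coe_le_coe_iff.2 (by linarith)

theorem represents_coreAssignment (hρ : IsCoherentRiskMeasure ρ) (hρL : IsLebesgueContinuous ρ) :
    Represents (coreSet h𝒢 ρ) (coreAssignment h𝒢 ρ) ρ := by
  intro X
  simp only [coreAssignment, add_sub_cancel]
  refine IsGreatest.isLUB ⟨?_, ?_⟩
  · obtain ⟨μ, hμ, h⟩ := exists_fiberSup_eq (h𝒢 := h𝒢) hρ hρL X
    exact ⟨⟨μ, hμ⟩, h⟩
  · rintro _ ⟨μ, rfl⟩
    exact fiberSup_le_self hρ μ.2 X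

end Core

end RiskMeasure

/-- Separation of a point from a closed convex subset of `E × ℝ`, with `E` weakly topologized. -/
theorem WeakBilin.exists_separating_closed_point {E F : Type*} [AddCommGroup E] [Module ℝ E]
    [AddCommGroup F] [Module ℝ F] (B : E →ₗ[ℝ] F →ₗ[ℝ] ℝ) {C : Set (WeakBilin B × ℝ)}
    (hconv : Convex ℝ C) (hclosed : IsClosed C) {p : WeakBilin B × ℝ} (hp : p ∉ C) :
    ∃ (y : F) (s u : ℝ), (∀ q ∈ C, B q.1 y + s * q.2 < u) ∧ u < B p.1 y + s * p.2 := by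
  obtain ⟨f, u, h1, h2⟩ := geometric_hahn_banach_closed_point hconv hclosed hp
  -- Every weakly continuous functional on the first factor has the form `B · y`.
  obtain ⟨y, hy⟩ := LinearMap.dualEmbedding_surjective B
    (f.comp (ContinuousLinearMap.inl ℝ (WeakBilin B) ℝ))
  have key : ∀ q : WeakBilin B × ℝ, f q = B q.1 y + f (0, 1) * q.2 := fun q => by
    have e1 : B q.1 y = f (q.1, 0) := DFunLike.congr_fun hy q.1
    have e2 : f (0, 1) * q.2 = f (0, q.2) := by
      rw [mul_comm, ← smul_eq_mul, ← map_smul]; simp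
    rw [e1, e2, ← map_add]; simp
  exact ⟨y, f (0, 1), u, fun q hq => key q ▸ h1 q hq, key p ▸ h2⟩

/-- Separation of a point from a closed convex subset of `E × ℝ`, where `E` carries the coarsest
topology that makes the functionals `B · y` continuous. -/
theorem exists_separating_of_isClosed_induced {E F : Type*} [AddCommGroup E] [Module ℝ E]
    [AddCommGroup F] [Module ℝ F] (B : E →ₗ[ℝ] F →ₗ[ℝ] ℝ) {C : Set (E × ℝ)} (hconv : Convex ℝ C)
    (hclosed : @IsClosed _ (@instTopologicalSpaceProd _ _
      (TopologicalSpace.induced (fun x y => B x y) Pi.topologicalSpace) _) C)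
    {p : E × ℝ} (hp : p ∉ C) :
    ∃ (y : F) (s u : ℝ), (∀ q ∈ C, B q.1 y + s * q.2 < u) ∧ u < B p.1 y + s * p.2 := by
  have hconv' : @Convex ℝ (WeakBilin B × ℝ) _ _ _ _ C := hconv
  have hclosed' : @IsClosed (WeakBilin B × ℝ) _ C := hclosed
  exact WeakBilin.exists_separating_closed_point B hconv' hclosed' hp

namespace RiskMeasure

/-! ### Uniqueness: separation in the weak topology. -/

section Uniqueness

set_option linter.unusedSectionVars false

variable {Ω : Type u} {𝒢 : MeasurableSpace Ω} [ℱ : MeasurableSpace Ω] {h𝒢 : 𝒢 ≤ ℱ}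
  {P : Measure Ω} [IsProbabilityMeasure P] {ρ : LInf P → ℝ}
  {R : Set (acSignedMeasures P h𝒢)} {τ : R → LInf P → ℝ}

/-- The pairing of `ℳ(𝒢)` with `L^∞(𝒢)`. -/
noncomputable abbrev pairing (P : Measure Ω) [IsProbabilityMeasure P] (h𝒢 : 𝒢 ≤ ℱ) :
    acSignedMeasures P h𝒢 →ₗ[ℝ] LInfSub 𝒢 P →ₗ[ℝ] ℝ :=
  (expectₗ P h𝒢).domRestrict₂ (LInfSub 𝒢 P)

theorem pairing_injective : Function.Injective (pairing P h𝒢) := fun _ _ h =>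
  expect_injective fun Y hY => DFunLike.congr_fun h (⟨Y, hY⟩ : LInfSub 𝒢 P)

/-- The weak topology is Hausdorff, since indicators of sets in `𝒢` separate measures. -/
theorem isClosed_of_isCompact (hR : @IsCompact _ (weakTopology P h𝒢) R) :
    @IsClosed _ (weakTopology P h𝒢) R := by
  have : T2Space (WeakBilin (pairing P h𝒢)) :=
    (WeakBilin.isEmbedding (pairing_injective (P := P) (h𝒢 := h𝒢))).t2Space
  exact @IsCompact.isClosed (WeakBilin (pairing P h𝒢)) _ _ R hR

theorem exists_separating_expect {C : Set (acSignedMeasures P h𝒢 × ℝ)} (hconv : Convex ℝ C)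
    (hclosed : @IsClosed _ (@instTopologicalSpaceProd _ _ (weakTopology P h𝒢) _) C)
    {μ : acSignedMeasures P h𝒢} {c : ℝ} (hp : (μ, c) ∉ C) :
    ∃ Y ∈ LInfSub 𝒢 P, ∃ s u : ℝ, (∀ ν r, (ν, r) ∈ C → expect ν Y + s * r < u) ∧
      u < expect μ Y + s * c := by
  have key := exists_separating_of_isClosed_induced (pairing P h𝒢) (C := C) (p := (μ, c)) hconv
  have key' := key hclosed hp
  obtain ⟨y, s, u, h1, h2⟩ := key'
  exact ⟨y, y.2, s, u, fun ν r h => h1 (ν, r) h, h2⟩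

/-- Upper semicontinuity from the net condition: if it failed, each neighbourhood of `μ` would
contain a point of `R` with value at least `c`, and these points would form a net converging to `μ`
whose limit inferior is at least `c`. -/
theorem IsRegularAssignment.eventually_lt (hτ : IsRegularAssignment R τ) (X : LInf P) (μ : R)
    {c : ℝ} (hc : τ μ X < c) :
    ∀ᶠ ν in @nhds _ (weakTopology P h𝒢) (μ : acSignedMeasures P h𝒢),
      ∀ hν : ν ∈ R, τ ⟨ν, hν⟩ X < c := by
  let _ := weakTopology P h𝒢
  by_contra hcon
  have h : ∀ U ∈ 𝓝 (μ : acSignedMeasures P h𝒢), ∃ ν : R, (ν : acSignedMeasures P h𝒢) ∈ U ∧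
      c ≤ τ ν X := by
    intro U hU
    by_contra! h
    exact hcon (mem_of_superset hU fun ν hνU hν => h ⟨ν, hν⟩ hνU)
  -- Neighbourhoods under reverse inclusion; this index type lies in the universe `u` over which
  -- regularity quantifies.
  let Λ := {U : Set (acSignedMeasures P h𝒢) // U ∈ 𝓝 (μ : acSignedMeasures P h𝒢)}ᵒᵈ
  have : Nonempty Λ := ⟨OrderDual.toDual ⟨Set.univ, univ_mem⟩⟩
  have : IsDirectedOrder Λ := ⟨fun a b =>
    ⟨OrderDual.toDual ⟨a.ofDual.1 ∩ b.ofDual.1, inter_mem a.ofDual.2 b.ofDual.2⟩,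
      Set.inter_subset_left, Set.inter_subset_right⟩⟩
  choose m hm hmc using fun U : Λ => h U.ofDual.1 U.ofDual.2
  have hlim : Tendsto (fun i => (m i : acSignedMeasures P h𝒢)) atTop (𝓝 μ) := by
    intro U hU
    exact mem_map.2 (mem_of_superset (mem_atTop (OrderDual.toDual ⟨U, hU⟩ : Λ)) fun i hi =>
      hi (hm i))
  have h1 := hτ.semicontinuous Λ m μ hlim X
  have h2 : (c : EReal) ≤ liminf (fun i => (τ (m i) X : EReal)) atTop :=
    le_liminf_of_le (by isBoundedDefault)
      (Eventually.of_forall fun i => EReal.coe_le_coe_iff.2 (hmc i))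
  exact absurd (EReal.coe_le_coe_iff.1 (h2.trans h1)) (not_le.2 hc)

/-- The hypograph of `μ ↦ 𝔼^μ[X] + τ_μ(X)`. -/
def hypograph (τ : R → LInf P → ℝ) (X : LInf P) : Set (acSignedMeasures P h𝒢 × ℝ) :=
  {p | ∃ hp : p.1 ∈ R, p.2 ≤ expect p.1 X + τ ⟨p.1, hp⟩ X}

theorem convex_hypograph (hR : Convex ℝ R) (hτ : IsRegularAssignment R τ) (X : LInf P) :
    Convex ℝ (hypograph τ X) := by
  refine convex_iff_forall_pos.2 ?_
  rintro ⟨μ, r⟩ ⟨hμ, hr⟩ ⟨ν, s⟩ ⟨hν, hs⟩ a b ha hb hab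
  obtain rfl : b = 1 - a := by linarith
  refine ⟨hR hμ hν ha.le hb.le hab, ?_⟩
  have h1 := hτ.concave X ⟨μ, hμ⟩ ⟨ν, hν⟩ ⟨_, hR hμ hν ha.le hb.le hab⟩ a ha (by linarith) rfl
  have h2 := expect_smul_add_smul (h𝒢 := h𝒢) μ ν a (1 - a) X
  have h3 := mul_le_mul_of_nonneg_left hr ha.le
  have h4 := mul_le_mul_of_nonneg_left hs hb.le
  change a * r + (1 - a) * s ≤ expect (a • μ + (1 - a) • ν : acSignedMeasures P h𝒢) X + _
  rw [h2]
  refine le_trans ?_ (add_le_add_right h1 _)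
  simp only at h3 h4
  linarith

theorem isClosed_hypograph (hR : @IsCompact _ (weakTopology P h𝒢) R)
    (hτ : IsRegularAssignment R τ) (X : LInf P) :
    @IsClosed _ (@instTopologicalSpaceProd _ _ (weakTopology P h𝒢) _) (hypograph τ X) := by
  let _ := weakTopology P h𝒢
  rw [← isOpen_compl_iff, isOpen_iff_mem_nhds]
  rintro ⟨μ, r⟩ hp
  rw [nhds_prod_eq]
  by_cases hμ : μ ∈ R
  · have hr : expect (μ : acSignedMeasures P h𝒢) X + τ ⟨μ, hμ⟩ X < r := by
      by_contra! h
      exact hp ⟨hμ, h⟩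
    -- The gap is split in three: one `ε` each for the variation of the expectation, of the
    -- adjustment and of the height.
    obtain ⟨ε, hε, he⟩ : ∃ ε > 0,
        expect (μ : acSignedMeasures P h𝒢) X + τ ⟨μ, hμ⟩ X + 3 * ε = r :=
      ⟨(r - (expect (μ : acSignedMeasures P h𝒢) X + τ ⟨μ, hμ⟩ X)) / 3, by linarith, by ring⟩
    have h1 := hτ.eventually_lt X ⟨μ, hμ⟩ (lt_add_of_pos_right _ hε)
    have h2 := (tendsto_expect (h𝒢 := h𝒢) (m := id) (μ := μ) tendsto_id X).eventually_lt_const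
      (lt_add_of_pos_right _ hε)
    have h3 : ∀ᶠ s in 𝓝 r, r - ε < s := eventually_gt_nhds (by linarith)
    refine mem_of_superset (prod_mem_prod (h1.and h2) h3) ?_
    rintro ⟨ν, s⟩ ⟨⟨h1, h2⟩, h3⟩ ⟨hν, hs⟩
    have h4 := h1 hν
    simp only [id] at h2 hs h3
    change r - ε < s at h3
    linarith
  · have hU : Rᶜ ∈ 𝓝 μ :=
      (isClosed_of_isCompact hR).isOpen_compl.mem_nhds hμ
    refine mem_of_superset (prod_mem_prod hU univ_mem) ?_
    rintro ⟨ν, s⟩ ⟨h1, -⟩ ⟨hν, -⟩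
    exact h1 hν

theorem coreSet_subset_of_represents (hR : @IsCompact _ (weakTopology P h𝒢) R)
    (hconv : Convex ℝ R) (hle : ∀ Y ∈ LInfSub 𝒢 P, ∀ a, (∀ μ ∈ R, expect μ Y ≤ a) → ρ Y ≤ a) :
    coreSet h𝒢 ρ ⊆ R := by
  intro μ hμ
  by_contra hμR
  -- Separating `(μ, 0)` from the cylinder `R × ℝ` amounts to separating `μ` from `R`; evaluation at
  -- height `0` removes the coefficient `s`.
  have hRc : Convex ℝ {p : acSignedMeasures P h𝒢 × ℝ | p.1 ∈ R} :=
    hconv.linear_preimage (LinearMap.fst ℝ _ _)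
  have hcl : @IsClosed _ (@instTopologicalSpaceProd _ _ (weakTopology P h𝒢) _)
      {p : acSignedMeasures P h𝒢 × ℝ | p.1 ∈ R} := by
    let _ := weakTopology P h𝒢
    exact (isClosed_of_isCompact hR).preimage continuous_fst
  obtain ⟨Y, hY, s, u, h1, h2⟩ := exists_separating_expect hRc hcl (c := 0) hμR
  have h3 := hle Y hY u fun ν hν => by
    have := h1 ν 0 hν
    rw [mul_zero, add_zero] at this
    exact this.le
  rw [mul_zero, add_zero] at h2
  exact absurd (h3.trans_lt h2) (not_lt.2 (hμ Y hY))

theorem IsCoherentAdjustment.apply_of_mem {μ : acSignedMeasures P h𝒢} {t : LInf P → ℝ}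
    (ht : IsCoherentAdjustment μ t) {Y : LInf P} (hY : Y ∈ LInfSub 𝒢 P) : t Y = 0 := by
  rw [← zero_add Y, ht.invariant 0 Y hY, ht.pos_homogeneous.map_zero]

theorem eq_coreSet (hR : @IsCompact _ (weakTopology P h𝒢) R) (hconv : Convex ℝ R)
    (hCA : IsCAAssignment R τ) (hrep : Represents R τ ρ) : R = coreSet h𝒢 ρ := by
  refine Set.Subset.antisymm (fun μ hμ Y hY => ?_)
    (coreSet_subset_of_represents hR hconv fun Y hY a h => (hrep Y).2 ?_)
  · have := (hrep Y).1 ⟨⟨μ, hμ⟩, rfl⟩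
    simp only at this
    rwa [(hCA ⟨μ, hμ⟩).1.apply_of_mem hY, add_zero] at this
  · rintro _ ⟨μ, rfl⟩
    simpa only [(hCA μ).1.apply_of_mem hY, add_zero] using h μ μ.2

/-- The representation at `X + Y` with invariance gives `≤`. If the inequality were strict, a height
`c` strictly between would put `(μ, c)` off the closed convex hypograph, and the separating
functional would yield a `Y` with `ρ(X + Y) - 𝔼^μ[Y] < c`. -/
theorem eq_fiberSup (hρ : IsCoherentRiskMeasure ρ) (hR : @IsCompact _ (weakTopology P h𝒢) R)
    (hconv : Convex ℝ R) (hCA : IsCAAssignment R τ) (hτ : IsRegularAssignment R τ)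
    (hrep : Represents R τ ρ) (μ : R) (X : LInf P) :
    expect (μ : acSignedMeasures P h𝒢) X + τ μ X = fiberSup ρ (μ : acSignedMeasures P h𝒢) X := by
  have hμ : (μ : acSignedMeasures P h𝒢) ∈ coreSet h𝒢 ρ :=
    eq_coreSet hR hconv hCA hrep ▸ μ.2
  refine le_antisymm (le_fiberSup fun Y hY => ?_) (le_of_not_gt fun hlt => ?_)
  · have := (hrep (X + Y)).1 ⟨μ, rfl⟩
    simp only [(hCA μ).1.invariant X Y hY, expect_add] at this
    linarith
  · obtain ⟨c, hc1, hc2⟩ := exists_between hlt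
    obtain ⟨y, hy, s, u, h1, h2⟩ := exists_separating_expect (convex_hypograph hconv hτ X)
      (isClosed_hypograph hR hτ X) fun ⟨_, h⟩ => not_lt.2 h hc1
    -- The hypograph contains a point below `(μ, c)` on the same vertical line, so the separating
    -- functional must increase with height.
    have hs : 0 < s := by
      have h3 := h1 μ (expect (μ : acSignedMeasures P h𝒢) X + τ μ X) ⟨μ.2, le_rfl⟩
      by_contra! hs
      have := mul_le_mul_of_nonpos_left hc1.le hs
      linarith
    have hY : s⁻¹ • y ∈ LInfSub 𝒢 P := Submodule.smul_mem _ _ hy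
    -- After division by `s`, the separation bounds `𝔼^ν[X + Y] + τ_ν(X + Y)` for all `ν ∈ R`, with
    -- `Y = s⁻¹ • y`.
    have h3 : ρ (X + s⁻¹ • y) ≤ s⁻¹ * u := by
      refine (hrep _).2 ?_
      rintro _ ⟨ν, rfl⟩
      have h4 := h1 ν (expect (ν : acSignedMeasures P h𝒢) X + τ ν X) ⟨ν.2, le_rfl⟩
      simp only [(hCA ν).1.invariant X _ hY, expect_add, expect_smul] at h4 ⊢
      have h5 := mul_le_mul_of_nonneg_left h4.le (inv_pos.2 hs).le
      rw [mul_add, inv_mul_cancel_left₀ hs.ne'] at h5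
      linarith
    have h4 := fiberSup_le hρ hμ X hY
    have h5 := mul_le_mul_of_nonneg_left h2.le (inv_pos.2 hs).le
    rw [mul_add, inv_mul_cancel_left₀ hs.ne'] at h5
    rw [expect_smul] at h4
    linarith

end Uniqueness

end RiskMeasure

theorem mainTheorem9 {Ω : Type u} {𝒢 : MeasurableSpace Ω} [ℱ : MeasurableSpace Ω]
    (h𝒢 : 𝒢 ≤ ℱ) (P : Measure Ω) [IsProbabilityMeasure P]
    (ρ : LInf P → ℝ) (hρ : IsCoherentRiskMeasure ρ) (hρL : IsLebesgueContinuous ρ) :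
    ∃! p : (R : Set (acSignedMeasures P h𝒢)) × (R → LInf P → ℝ),
      p.1 ⊆ acProbabilities P h𝒢 ∧
      @IsCompact _ (weakTopology P h𝒢) p.1 ∧
      Convex ℝ p.1 ∧
      IsCAAssignment p.1 p.2 ∧
      (∀ μ : p.1, IsLebesgueContinuous (p.2 μ)) ∧
      IsRegularAssignment p.1 p.2 ∧
      Represents p.1 p.2 ρ := by
  refine ⟨⟨coreSet h𝒢 ρ, coreAssignment h𝒢 ρ⟩, ⟨coreSet_subset_acProbabilities hρ,
    isCompact_coreSet hρ hρL, convex_coreSet, isCAAssignment_coreAssignment hρ hρL,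
    isLebesgueContinuous_coreAssignment hρ hρL, isRegularAssignment_coreAssignment hρ,
    represents_coreAssignment hρ hρL⟩, ?_⟩
  rintro ⟨R, τ⟩ ⟨-, hR, hconv, hCA, -, hτ, hrep⟩
  -- The sets are identified first because the domain of `τ` depends on `R`.
  obtain rfl : R = coreSet h𝒢 ρ := eq_coreSet hR hconv hCA hrep
  obtain rfl : τ = coreAssignment h𝒢 ρ := funext fun μ => funext fun X =>
    eq_sub_of_add_eq' (eq_fiberSup hρ hR hconv hCA hτ hrep μ X)
  rfl
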